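/- Let $\Sigma$ be a non-empty set of proposition letters, and consider infinite words $\sigma=\sigma_0\sigma_1\sigma_2\cdots$ over the alphabet $2^\Sigma$. **Temporal fragments.** Formulas of $\mathsf{LTL}$ are built from letters $p\in\Sigma$ with $\neg,\lor,\land$, tomorrow $\mathsf{X}$, weak tomorrow $\mathsf{wX}$, until $\mathsf{U}$ and release $\mathsf{R}$, with the usual semantics over infinite words (where $\mathsf{X}$ and $\mathsf{wX}$ coincide). $\mathsf{coSafetyLTL}$ (resp. $\mathsf{SafetyLTL}$) is the set of $\mathsf{LTL}$ formulas in negated normal form (negation is applied to letters only) whose temporal operators are only $\mathsf{X}$, $\mathsf{wX}$ and $\mathsf{U}$ (resp. only $\mathsf{X}$, $\mathsf{wX}$ and $\mathsf{R}$). The language of $\phi$ is $\mathcal{L}(\phi)=\{\sigma\in(2^\Sigma)^\omega : \sigma,0\models\phi\}$. **First-order fragments.** Consider first-order logic with equality, the order symbol $<$ and a unary predicate $P_p$ for each $p\in\Sigma$. A word $\sigma$ is viewed as the structure with domain $\mathbb{N}$, the usual order, and $P_p=\{i : p\in\sigma_i\}$. The fragment $\mathsf{coSafetyFO}$ is generated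 by $$\phi ::= x<y \mid x=y \mid x\neq y \mid P_p(x)\mid \neg P_p(x)\mid \phi\lor\phi\mid\phi\land\phi\mid \exists y\,(x<y\land\phi)\mid\forall y\,(x<y<z\rightarrow\phi),$$ and $\mathsf{SafetyFO}$ by the same grammar with the two quantified forms replaced by $\exists y\,(x<y<z\land\phi)$ and $\forall y\,(x<y\rightarrow\phi)$; in the quantified forms the guard variables $x,z$ are different from the bound variable $y$. The language of a formula $\phi(x)$ with exactly one free variable $x$ is the set $\mathcal{L}(\phi)$ of all $\sigma\in(2^\Sigma)^\omega$ that satisfy $\phi(x)$ when $x=0$. For a temporal logic $\mathsf{L}$ let $[\![\mathsf{L}]\!]$ be the set of languages $\mathcal{L}(\phi)$ with $\phi\in\mathsf{L}$; for a first-order fragment $\mathsf{L}$ let $[\![\mathsf{L}]\!]$ be the set of languages $\mathcal{L}(\phi)$ of formulas $\phi\in\mathsf{L}$ with exactly one free variable. **Theorem.** $[\![\mathsf{coSafetyLTL}]\!]=[\![\mathsf{coSafetyFO}]\!]$ and $[\![\mathsf{SafetyLTL}]\!]=[\![\mathsf{SafetyFO}]\!]$. -/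

import Mathlib

universe u

/-- Infinite state sequences over the proposition letters `P`, that is, infinite words over the
alphabet of all subsets of `P`. -/
abbrev StateSeq (P : Type u) : Type u := ℕ → Set P

/-! ### Linear temporal logic (future modalities only) -/

/-- Formulas of linear temporal logic. -/
inductive LTL (P : Type u) : Type u
  | letter (p : P)
  | neg (φ : LTL P)
  | or (φ ψ : LTL P)
  | and (φ ψ : LTL P)
  | next (φ : LTL P)
  | wnext (φ : LTL P)
  | untl (φ ψ : LTL P)
  | release (φ ψ : LTL P)

namespace LTL

variable {P : Type u}

/-- `Sat σ i φ`: the infinite word `σ` satisfies `φ` at time point `i`. An infinite word has no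
last position, so `wnext` (true at a last position) and `next` (false there) agree on it. -/
def Sat (σ : StateSeq P) : ℕ → LTL P → Prop
  | i, letter p => p ∈ σ i
  | i, neg φ => ¬ Sat σ i φ
  | i, or φ ψ => Sat σ i φ ∨ Sat σ i ψ
  | i, and φ ψ => Sat σ i φ ∧ Sat σ i ψ
  | i, next φ => Sat σ (i + 1) φ
  | i, wnext φ => Sat σ (i + 1) φ
  | i, untl φ ψ => ∃ j, i ≤ j ∧ Sat σ j ψ ∧ ∀ k, i ≤ k → k < j → Sat σ k φ
  | i, release φ ψ => (∀ j, i ≤ j → Sat σ j ψ) ∨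
      ∃ k, i ≤ k ∧ Sat σ k φ ∧ ∀ j, i ≤ j → j ≤ k → Sat σ j ψ

/-- The language of infinite words of a formula. -/
def language (φ : LTL P) : Set (StateSeq P) := {σ | Sat σ 0 φ}

/-- coSafetyLTL: formulas in negated normal form with only tomorrow, weak tomorrow and until. -/
inductive IsCoSafety : LTL P → Prop
  | letter (p : P) : IsCoSafety (letter p)
  | negLetter (p : P) : IsCoSafety (neg (letter p))
  | or {φ ψ : LTL P} : IsCoSafety φ → IsCoSafety ψ → IsCoSafety (or φ ψ)
  | and {φ ψ : LTL P} : IsCoSafety φ → IsCoSafety ψ → IsCoSafety (and φ ψ)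
  | next {φ : LTL P} : IsCoSafety φ → IsCoSafety (next φ)
  | wnext {φ : LTL P} : IsCoSafety φ → IsCoSafety (wnext φ)
  | untl {φ ψ : LTL P} : IsCoSafety φ → IsCoSafety ψ → IsCoSafety (untl φ ψ)

/-- SafetyLTL: formulas in negated normal form with only tomorrow, weak tomorrow and release. -/
inductive IsSafety : LTL P → Prop
  | letter (p : P) : IsSafety (letter p)
  | negLetter (p : P) : IsSafety (neg (letter p))
  | or {φ ψ : LTL P} : IsSafety φ → IsSafety ψ → IsSafety (or φ ψ)
  | and {φ ψ : LTL P} : IsSafety φ → IsSafety ψ → IsSafety (and φ ψ)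
  | next {φ : LTL P} : IsSafety φ → IsSafety (next φ)
  | wnext {φ : LTL P} : IsSafety φ → IsSafety (wnext φ)
  | release {φ ψ : LTL P} : IsSafety φ → IsSafety ψ → IsSafety (release φ ψ)

end LTL

/-- The class of languages of infinite words definable in coSafetyLTL. -/
def coSafetyLTLLanguages (P : Type u) : Set (Set (StateSeq P)) :=
  {L | ∃ φ : LTL P, φ.IsCoSafety ∧ L = φ.language}

/-- The class of languages of infinite words definable in SafetyLTL. -/
def safetyLTLLanguages (P : Type u) : Set (Set (StateSeq P)) :=
  {L | ∃ φ : LTL P, φ.IsSafety ∧ L = φ.language}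

/-! ### First-order logic of linear orders -/

/-- First-order formulas with equality over the signature with the binary symbol `<` and one unary
predicate symbol for each proposition letter. Variables are named by natural numbers. -/
inductive FO (P : Type u) : Type u
  | lt (x y : ℕ)
  | eq (x y : ℕ)
  | pred (p : P) (x : ℕ)
  | neg (φ : FO P)
  | or (φ ψ : FO P)
  | and (φ ψ : FO P)
  | imp (φ ψ : FO P)
  | ex (y : ℕ) (φ : FO P)
  | all (y : ℕ) (φ : FO P)

namespace FO

variable {P : Type u}

/-- Free variables. -/
def freeVars : FO P → Finset ℕ
  | lt x y => {x, y}
  | eq x y => {x, y}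
  | pred _ x => {x}
  | neg φ => freeVars φ
  | or φ ψ => freeVars φ ∪ freeVars ψ
  | and φ ψ => freeVars φ ∪ freeVars ψ
  | imp φ ψ => freeVars φ ∪ freeVars ψ
  | ex y φ => (freeVars φ).erase y
  | all y φ => (freeVars φ).erase y

/-- Satisfaction under the assignment `v` in the structure of the infinite word `σ`: the domain is
`ℕ` with its usual order, and the predicate of `p` holds at the positions whose letter has `p`. -/
def Sat (σ : StateSeq P) : (ℕ → ℕ) → FO P → Prop
  | v, lt x y => v x < v y
  | v, eq x y => v x = v y
  | v, pred p x => p ∈ σ (v x)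
  | v, neg φ => ¬ Sat σ v φ
  | v, or φ ψ => Sat σ v φ ∨ Sat σ v ψ
  | v, and φ ψ => Sat σ v φ ∧ Sat σ v ψ
  | v, imp φ ψ => Sat σ v φ → Sat σ v ψ
  | v, ex y φ => ∃ n : ℕ, Sat σ (Function.update v y n) φ
  | v, all y φ => ∀ n : ℕ, Sat σ (Function.update v y n) φ

/-- The language of infinite words of a formula with exactly one free variable: the words that
satisfy the formula when its free variable is position `0`. (The values of the other variables
are irrelevant.) -/
def language (φ : FO P) : Set (StateSeq P) := {σ | Sat σ (fun _ => 0) φ}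

/-- The atomic formulas `x < y`, `x = y`, `x ≠ y`, `p(x)`, `¬ p(x)` of both fragments. -/
inductive IsAtomic : FO P → Prop
  | lt (x y : ℕ) : IsAtomic (lt x y)
  | eq (x y : ℕ) : IsAtomic (eq x y)
  | ne (x y : ℕ) : IsAtomic (neg (eq x y))
  | pred (p : P) (x : ℕ) : IsAtomic (pred p x)
  | negPred (p : P) (x : ℕ) : IsAtomic (neg (pred p x))

/-- coSafetyFO: atomic formulas, disjunction, conjunction, `∃ y (x < y ∧ φ)` and
`∀ y (x < y < z → φ)`, where the variables of the guard stay free (they differ from `y`). -/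
inductive IsCoSafety : FO P → Prop
  | atomic {φ : FO P} : IsAtomic φ → IsCoSafety φ
  | or {φ ψ : FO P} : IsCoSafety φ → IsCoSafety ψ → IsCoSafety (or φ ψ)
  | and {φ ψ : FO P} : IsCoSafety φ → IsCoSafety ψ → IsCoSafety (and φ ψ)
  | ex {x y : ℕ} {φ : FO P} : x ≠ y → IsCoSafety φ →
      IsCoSafety (ex y (and (lt x y) φ))
  | all {x y z : ℕ} {φ : FO P} : x ≠ y → z ≠ y → IsCoSafety φ →
      IsCoSafety (all y (imp (and (lt x y) (lt y z)) φ))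

/-- SafetyFO: atomic formulas, disjunction, conjunction, `∃ y (x < y < z ∧ φ)` and
`∀ y (x < y → φ)`, where the variables of the guard stay free (they differ from `y`). -/
inductive IsSafety : FO P → Prop
  | atomic {φ : FO P} : IsAtomic φ → IsSafety φ
  | or {φ ψ : FO P} : IsSafety φ → IsSafety ψ → IsSafety (or φ ψ)
  | and {φ ψ : FO P} : IsSafety φ → IsSafety ψ → IsSafety (and φ ψ)
  | ex {x y z : ℕ} {φ : FO P} : x ≠ y → z ≠ y → IsSafety φ →
      IsSafety (ex y (and (and (lt x y) (lt y z)) φ))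
  | all {x y : ℕ} {φ : FO P} : x ≠ y → IsSafety φ →
      IsSafety (all y (imp (lt x y) φ))

end FO

/-- The class of languages of infinite words definable by coSafetyFO formulas with exactly one
free variable. -/
def coSafetyFOLanguages (P : Type u) : Set (Set (StateSeq P)) :=
  {L | ∃ (φ : FO P) (x : ℕ), φ.IsCoSafety ∧ φ.freeVars = {x} ∧ L = φ.language}

/-- The class of languages of infinite words definable by SafetyFO formulas with exactly one
free variable. -/
def safetyFOLanguages (P : Type u) : Set (Set (StateSeq P)) :=
  {L | ∃ (φ : FO P) (x : ℕ), φ.IsSafety ∧ φ.freeVars = {x} ∧ L = φ.language}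

/-!
In both logics, the languages of the safety fragment are the complements of the languages of the
co-safety fragment (`LTL.mem_safetyLTLLanguages_iff`, `FO.mem_safetyFOLanguages_iff`), so only the co-safety
fragments have to be compared. The inclusion from temporal to first-order logic is the standard
translation (`LTL.IsCoSafety.exists_fo`). The converse is a version of Kamp's theorem, proved
through finite aperiodic monoids.

A word satisfies a coSafetyFO formula if and only if some nonempty finite prefix does, with all
quantifiers restricted to the prefix (`FO.IsCoSafety.sat_iff_exists_boundedSat`). Over finite
prefixes, every first-order formula is recognised by a finite aperiodic monoid
(`FO.recognisable_boundedSat`): letters are extended by the set of variables located at their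
position, products of monoids handle the connectives, and the monoid `MarkedProduct M`, which
collects the values of all ways to mark one position, handles an existential quantifier.

It remains to express in coSafetyLTL that some prefix has a prescribed value in a finite aperiodic
monoid, and this is the point of `TemporallyClosed.run_mem`, an adaptation of the local divisor
technique of Diekert and Gastin. Fix a letter `c` whose value is not the identity. A run splits at
the occurrences of `c` into blocks over a smaller alphabet. The blocks form a word over the new
alphabet `M` of block values, and this word is evaluated in the local divisor `cM ∩ Mc`, which is
smaller than `M` because the identity does not belong to it. The technique is carried out for an
arbitrary family of sets of states closed under union, intersection, next and until along a
deterministic step relation. Such a family is also closed under next and until along the coarser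
relation that advances by a whole block (`TemporallyClosed.block`), so the induction hypothesis
applies to blocks without any translation of formulas. The family need not be closed
under complement: a run and a block only ever assert which letter a state carries.
-/

/-! ### Aperiodic monoids -/

/-- A monoid is aperiodic if the powers of each element are eventually constant. -/
def IsAperiodic (M : Type*) [Monoid M] : Prop := ∀ x : M, ∃ n : ℕ, x ^ (n + 1) = x ^ n

theorem pow_eq_pow_of_succ {M : Type*} [Monoid M] {x : M} {n k : ℕ} (h : x ^ (n + 1) = x ^ n)
    (hk : n ≤ k) : x ^ (k + 1) = x ^ k := by
  obtain ⟨d, rfl⟩ := Nat.exists_eq_add_of_le hk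
  rw [add_right_comm, pow_add, h, ← pow_add]

theorem IsAperiodic.prod {M N : Type*} [Monoid M] [Monoid N] (hM : IsAperiodic M)
    (hN : IsAperiodic N) : IsAperiodic (M × N) := by
  rintro ⟨x, y⟩
  obtain ⟨n, hn⟩ := hM x
  obtain ⟨k, hk⟩ := hN y
  refine ⟨max n k, ?_⟩
  simp only [Prod.pow_mk, pow_eq_pow_of_succ hn (le_max_left n k),
    pow_eq_pow_of_succ hk (le_max_right n k)]

/-- In an aperiodic monoid only the identity has a right inverse. -/
theorem IsAperiodic.eq_one_of_mul_eq_one {M : Type*} [Monoid M] (hM : IsAperiodic M) {x y : M}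
    (h : x * y = 1) : x = 1 := by
  have hpow : ∀ n : ℕ, x ^ n * y ^ n = 1 := by
    intro n
    induction n with
    | zero => simp
    | succ n ih => rw [pow_succ, pow_succ', mul_assoc, ← mul_assoc x, h, one_mul, ih]
  obtain ⟨n, hn⟩ := hM x
  calc x = x ^ (n + 1) * y ^ n := by rw [pow_succ', mul_assoc, hpow, mul_one]
    _ = 1 := by rw [hn, hpow]

/-! ### Local divisors -/

/-- The local divisor of a monoid at `c`: the set `cM ∩ Mc`, with the product
`(ac) ∘ (cb) = acb` and the identity `c`. -/
def LocalDivisor {M : Type*} [Monoid M] (c : M) : Type _ :=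
  {x : M // (∃ a, x = a * c) ∧ ∃ b, x = c * b}

namespace LocalDivisor

variable {M : Type*} [Monoid M] {c : M}

/-- A chosen `a` such that the element is `ac`; the product does not depend on the choice. -/
noncomputable def cofactor (x : LocalDivisor c) : M := x.2.1.choose

theorem cofactor_mul (x : LocalDivisor c) : x.cofactor * c = x.1 := x.2.1.choose_spec.symm

noncomputable instance : Mul (LocalDivisor c) where
  mul x y := ⟨x.cofactor * y.1, by
    obtain ⟨⟨a, ha⟩, b, hb⟩ := y.2
    obtain ⟨b', hb'⟩ := x.2.2
    refine ⟨⟨x.cofactor * a, by rw [ha, mul_assoc]⟩, b' * b, ?_⟩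
    rw [hb, ← mul_assoc, cofactor_mul, hb', mul_assoc]⟩

instance : One (LocalDivisor c) where
  one := ⟨c, ⟨1, (one_mul c).symm⟩, 1, (mul_one c).symm⟩

theorem one_val : (1 : LocalDivisor c).1 = c := rfl

theorem mul_val_right (x y : LocalDivisor c) {b : M} (hb : y.1 = c * b) :
    (x * y).1 = x.1 * b := by
  change x.cofactor * y.1 = x.1 * b
  rw [hb, ← mul_assoc, cofactor_mul]

theorem mul_val_left (x y : LocalDivisor c) {a : M} (ha : x.1 = a * c) :
    (x * y).1 = a * y.1 := by
  obtain ⟨b, hb⟩ := y.2.2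
  rw [mul_val_right x y hb, ha, hb, mul_assoc]

noncomputable instance : Monoid (LocalDivisor c) where
  mul_assoc x y z := by
    apply Subtype.ext
    obtain ⟨b, hb⟩ := z.2.2
    obtain ⟨a, ha⟩ := x.2.1
    have h : (y * z).1 = y.1 * b := mul_val_right y z hb
    rw [mul_val_right (x * y) z hb, mul_val_left x y ha, mul_val_left x (y * z) ha, h, mul_assoc]
  one_mul x := Subtype.ext (by rw [mul_val_left 1 x (a := 1) (by rw [one_mul, one_val]), one_mul])
  mul_one x := Subtype.ext (by rw [mul_val_right x 1 (b := 1) (by rw [mul_one, one_val]), mul_one])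

instance [Finite M] : Finite (LocalDivisor c) := Subtype.finite

theorem isAperiodic (hM : IsAperiodic M) : IsAperiodic (LocalDivisor c) := by
  intro x
  obtain ⟨b, hb⟩ := x.2.2
  have hpow : ∀ n : ℕ, (x ^ n).1 = c * b ^ n := by
    intro n
    induction n with
    | zero => rw [pow_zero, pow_zero, mul_one, one_val]
    | succ n ih => rw [pow_succ, mul_val_right _ x hb, ih, pow_succ, mul_assoc]
  obtain ⟨n, hn⟩ := hM b
  exact ⟨n, Subtype.ext (by rw [hpow, hpow, hn])⟩

/-- The local divisor at a nontrivial element of a finite aperiodic monoid misses the identity, so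
it is strictly smaller. -/
theorem card_lt [Finite M] (hM : IsAperiodic M) (hc : c ≠ 1) :
    Nat.card (LocalDivisor c) < Nat.card M := by
  refine Finite.card_subtype_lt (x := (1 : M)) ?_
  rintro ⟨-, b, hb⟩
  exact hc (hM.eq_one_of_mul_eq_one hb.symm)

/-- The image `cmc` in the local divisor of a block of value `m`. -/
def conj (c m : M) : LocalDivisor c :=
  ⟨c * m * c, ⟨c * m, rfl⟩, m * c, mul_assoc c m c⟩

theorem conj_mul_val (m : M) (x : LocalDivisor c) : (conj c m * x).1 = c * m * x.1 :=
  mul_val_left _ _ rfl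

end LocalDivisor

/-! ### Families of sets closed under next and until -/

section Runs

variable {S : Type*}

/-- Until along the relation `R`: some `R`-path stays in `D` and then reaches `E`. -/
inductive Until (R : S → S → Prop) (D E : Set S) : S → Prop
  | here {s : S} : s ∈ E → Until R D E s
  | step {s t : S} : s ∈ D → R s t → Until R D E t → Until R D E s

/-- The states with an `R`-successor in `D`. -/
def Next (R : S → S → Prop) (D : Set S) : Set S := {s | ∃ t, R s t ∧ t ∈ D}

/-- A family of sets of states closed under the connectives and temporal operators of the
co-safety fragment, interpreted along `R`. -/
structure TemporallyClosed (R : S → S → Prop) (𝒟 : Set (Set S)) : Prop where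
  empty : ∅ ∈ 𝒟
  union {D E : Set S} : D ∈ 𝒟 → E ∈ 𝒟 → D ∪ E ∈ 𝒟
  inter {D E : Set S} : D ∈ 𝒟 → E ∈ 𝒟 → D ∩ E ∈ 𝒟
  next {D : Set S} : D ∈ 𝒟 → Next R D ∈ 𝒟
  untl {D E : Set S} : D ∈ 𝒟 → E ∈ 𝒟 → {s | Until R D E s} ∈ 𝒟

variable {R : S → S → Prop} {𝒟 : Set (Set S)}

theorem TemporallyClosed.biUnion {ι : Type*} (h𝒟 : TemporallyClosed R 𝒟) (B : Finset ι)
    {f : ι → Set S} (hf : ∀ i ∈ B, f i ∈ 𝒟) : (⋃ i ∈ B, f i) ∈ 𝒟 := by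
  classical
  induction B using Finset.induction_on with
  | empty => simpa using h𝒟.empty
  | insert a B _ ih =>
    rw [Finset.set_biUnion_insert]
    exact h𝒟.union (hf a (Finset.mem_insert_self a B))
      (ih fun i hi => hf i (Finset.mem_insert_of_mem hi))

theorem TemporallyClosed.iUnion {ι : Type*} [Finite ι] (h𝒟 : TemporallyClosed R 𝒟)
    {f : ι → Set S} (hf : ∀ i, f i ∈ 𝒟) : (⋃ i, f i) ∈ 𝒟 := by
  have := Fintype.ofFinite ι
  simpa using h𝒟.biUnion Finset.univ fun i _ => hf i

theorem TemporallyClosed.setOf_exists {ι : Type*} [Finite ι] (h𝒟 : TemporallyClosed R 𝒟)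
    {p : ι → S → Prop} (hp : ∀ i, {s | p i s} ∈ 𝒟) : {s | ∃ i, p i s} ∈ 𝒟 := by
  rw [Set.ofPred_exists]
  exact h𝒟.iUnion hp

theorem TemporallyClosed.setOf_and {q : Prop} {p : S → Prop} (h𝒟 : TemporallyClosed R 𝒟)
    (hp : q → {s | p s} ∈ 𝒟) : {s | q ∧ p s} ∈ 𝒟 := by
  by_cases hq : q
  · simpa [hq] using hp hq
  · simpa [hq] using h𝒟.empty

/-! ### Runs with a prescribed value -/

variable {A M : Type*} [Monoid M]

/-- `Run R V B h U m s`: from `s` there is a finite `R`-path ending in `U` whose states before the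
end carry letters of `B` (the states carrying `a` are `V a`) such that the product of the values
under `h` of the letters is `m`. -/
inductive Run (R : S → S → Prop) (V : A → Set S) (B : Finset A) (h : A → M) (U : Set S) :
    M → S → Prop
  | nil {s : S} : s ∈ U → Run R V B h U 1 s
  | cons {s t : S} {a : A} {m : M} : a ∈ B → s ∈ V a → R s t → Run R V B h U m t →
      Run R V B h U (h a * m) s

/-- `Block R V B c s t`: the state `t` is reached from `s` by an `R`-path with letters in `B`
followed by one step with the letter `c`. -/
inductive Block (R : S → S → Prop) (V : A → Set S) (B : Finset A) (c : A) : S → S → Prop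
  | last {s t : S} : s ∈ V c → R s t → Block R V B c s t
  | step {s r t : S} {a : A} : a ∈ B → s ∈ V a → R s r → Block R V B c r t → Block R V B c s t

variable {V : A → Set S} {B B' : Finset A} {h : A → M} {U W : Set S} {c : A}

theorem Run.append (hB : B' ⊆ B) {p q : M} {s : S} (hs : Run R V B' h W p s)
    (hW : ∀ t ∈ W, Run R V B h U q t) : Run R V B h U (p * q) s := by
  induction hs with
  | nil hs => rw [one_mul]; exact hW _ hs
  | cons ha hs hR _ ih => rw [mul_assoc]; exact .cons (hB ha) hs hR ih

/-- If all letters have trivial value, runs are an instance of until. -/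
theorem run_iff_of_forall_eq_one (h1 : ∀ a ∈ B, h a = 1) {m : M} {s : S} :
    Run R V B h U m s ↔ m = 1 ∧ Until R (⋃ a ∈ B, V a) U s := by
  constructor
  · intro hs
    induction hs with
    | nil hs => exact ⟨rfl, .here hs⟩
    | cons ha hs hR _ ih =>
      exact ⟨by rw [h1 _ ha, ih.1, one_mul], .step (Set.mem_biUnion ha hs) hR ih.2⟩
  · rintro ⟨rfl, hs⟩
    induction hs with
    | here hs => exact .nil hs
    | step hs hR _ ih =>
      obtain ⟨a, ha, hs⟩ := Set.mem_iUnion₂.1 hs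
      simpa [h1 a ha] using Run.cons (h := h) ha hs hR ih

theorem Run.exists_block {p : M} {s : S} (hs : Run R V B h (V c ∩ Next R W) p s) :
    Run R V B h (V c) p s ∧ ∃ t, Block R V B c s t ∧ t ∈ W := by
  induction hs with
  | nil hs =>
    obtain ⟨hc, t, hR, ht⟩ := hs
    exact ⟨.nil hc, t, .last hc hR, ht⟩
  | cons ha hs hR _ ih =>
    obtain ⟨hrun, t, hb, ht⟩ := ih
    exact ⟨.cons ha hs hR hrun, t, .step ha hs hR hb, ht⟩

theorem block_iff_until {s : S} : (∃ t, Block R V B c s t ∧ t ∈ W) ↔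
    Until R (⋃ a ∈ B, V a) (V c ∩ Next R W) s := by
  constructor
  · rintro ⟨t, hb, ht⟩
    induction hb with
    | last hs hR => exact .here ⟨hs, _, hR, ht⟩
    | step ha hs hR _ ih => exact .step (Set.mem_biUnion ha hs) hR (ih ht)
  · intro hs
    induction hs with
    | here hs =>
      obtain ⟨hc, t, hR, ht⟩ := hs
      exact ⟨t, .last hc hR, ht⟩
    | step hs hR _ ih =>
      obtain ⟨a, ha, hs⟩ := Set.mem_iUnion₂.1 hs
      obtain ⟨t, hb, ht⟩ := ih
      exact ⟨t, .step ha hs hR hb, ht⟩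

/-- Until along blocks is expressible by until along the underlying relation. -/
theorem until_block_iff {D E : Set S} {s : S}
    (hR : ∀ s t t', R s t → R s t' → t = t') : Until (Block R V B c) D E s ↔
    s ∈ E ∨ s ∈ D ∧ Until R ((⋃ a ∈ B, V a) ∪ (V c ∩ Next R D)) (V c ∩ Next R E) s := by
  constructor
  · intro hs
    induction hs with
    | here hs => exact .inl hs
    | @step s t hs hb _ ih =>
      refine .inr ⟨hs, ?_⟩
      clear hs
      induction hb with
      | last hc hRt =>
        rcases ih with ht | ⟨ht, hu⟩
        · exact .here ⟨hc, _, hRt, ht⟩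
        · exact .step (.inr ⟨hc, _, hRt, ht⟩) hRt hu
      | step ha hs hRr _ ih' => exact .step (.inl (Set.mem_biUnion ha hs)) hRr (ih' ‹_› ih)
  · rintro (hs | ⟨hs, hu⟩)
    · exact .here hs
    · have key : ∃ t, Block R V B c s t ∧ Until (Block R V B c) D E t := by
        clear hs
        induction hu with
        | here hs =>
          obtain ⟨hc, t, hRt, ht⟩ := hs
          exact ⟨t, .last hc hRt, .here ht⟩
        | step hs hRt _ ih =>
          obtain ⟨t', hb, ht'⟩ := ih
          rcases hs with hs | ⟨hc, t, hRt', ht⟩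
          · obtain ⟨a, ha, hs⟩ := Set.mem_iUnion₂.1 hs
            exact ⟨t', .step ha hs hRt hb, ht'⟩
          · obtain rfl := hR _ _ _ hRt hRt'
            exact ⟨_, .last hc hRt, .step ht hb ht'⟩
      obtain ⟨t, hb, ht⟩ := key
      exact .step hs hb ht

theorem TemporallyClosed.block (h𝒟 : TemporallyClosed R 𝒟)
    (hR : ∀ s t t', R s t → R s t' → t = t') (hV : ∀ a, V a ∈ 𝒟) :
    TemporallyClosed (Block R V B c) 𝒟 where
  empty := h𝒟.empty
  union := h𝒟.union
  inter := h𝒟.inter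
  next hD := by
    have := h𝒟.untl (h𝒟.biUnion B fun a _ => hV a) (h𝒟.inter (hV c) (h𝒟.next hD))
    simp only [← block_iff_until] at this
    exact this
  untl hD hE := by
    simp only [until_block_iff hR]
    exact h𝒟.union hE (h𝒟.inter hD (h𝒟.untl
      (h𝒟.union (h𝒟.biUnion B fun a _ => hV a) (h𝒟.inter (hV c) (h𝒟.next hD)))
      (h𝒟.inter (hV c) (h𝒟.next hE))))

/-- The value of a block is determined by its first state. -/
theorem Run.value_unique (hR : ∀ s t t', R s t → R s t' → t = t')
    (hV : ∀ a b s, s ∈ V a → s ∈ V b → a = b) (hc : c ∉ B) {m m' : M} {s : S}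
    (hs : Run R V B h (V c) m s) (hs' : Run R V B h (V c) m' s) : m = m' := by
  induction hs generalizing m' with
  | nil hs =>
    cases hs' with
    | nil => rfl
    | cons ha hs' => exact absurd (hV _ _ _ hs' hs ▸ ha) hc
  | cons ha hs hRt _ ih =>
    cases hs' with
    | nil hs' => exact absurd (hV _ _ _ hs hs' ▸ ha) hc
    | cons ha' hs' hRt' hrun =>
      obtain rfl := hV _ _ _ hs hs'
      obtain rfl := hR _ _ _ hRt hRt'
      rw [ih hrun]

theorem Block.target_unique (hR : ∀ s t t', R s t → R s t' → t = t')
    (hV : ∀ a b s, s ∈ V a → s ∈ V b → a = b) (hc : c ∉ B) (s t t' : S)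
    (hs : Block R V B c s t) (hs' : Block R V B c s t') : t = t' := by
  induction hs with
  | last hs hRt =>
    cases hs' with
    | last _ hRt' => exact hR _ _ _ hRt hRt'
    | step ha hs' => exact absurd (hV _ _ _ hs' hs ▸ ha) hc
  | step ha hs hRt _ ih =>
    cases hs' with
    | last hs' => exact absurd (hV _ _ _ hs hs' ▸ ha) hc
    | step ha' hs' hRt' hb =>
      obtain rfl := hR _ _ _ hRt hRt'
      exact ih hb

theorem Run.of_block (hR : ∀ s t t', R s t → R s t' → t = t')
    (hV : ∀ a b s, s ∈ V a → s ∈ V b → a = b) (hc : c ∉ B) {p : M} {s t : S}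
    (hs : Run R V B h (V c) p s) (hb : Block R V B c s t) (ht : t ∈ W) :
    Run R V B h (V c ∩ Next R W) p s := by
  induction hs with
  | nil hs =>
    cases hb with
    | last _ hRt => exact .nil ⟨hs, t, hRt, ht⟩
    | step ha hs' => exact absurd (hV _ _ _ hs' hs ▸ ha) hc
  | cons ha hs hRt _ ih =>
    cases hb with
    | last hs' => exact absurd (hV _ _ _ hs hs' ▸ ha) hc
    | step ha' hs' hRt' hb =>
      obtain rfl := hR _ _ _ hRt hRt'
      exact .cons ha hs hRt (ih hb)

/-- The alphabet of block values: the states that start a block of value `m`. -/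
def blockLetter (R : S → S → Prop) (V : A → Set S) (B : Finset A) (h : A → M) (c : A) (m : M) :
    Set S := {s | Run R V B h (V c) m s}

/-- A run over block values in the local divisor unfolds to a run over letters; its value lacks the
letter `c` that precedes the first block. -/
theorem exists_run_of_run_block (hR : ∀ s t t', R s t → R s t' → t = t')
    (hV : ∀ a b s, s ∈ V a → s ∈ V b → a = b) (hc : c ∉ B') (hcB : c ∈ B) (hB : B' ⊆ B)
    {C : Finset M} {q : M} {x : LocalDivisor (h c)} {s : S}
    (hs : Run (Block R V B' c) (blockLetter R V B' h c) C (LocalDivisor.conj (h c)) W x s)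
    (hW : ∀ t ∈ W, Run R V B h U q t) :
    ∃ r, x.1 = h c * r ∧ Run R V B h U (r * q) s := by
  induction hs with
  | nil hs => exact ⟨1, (mul_one _).symm, by rw [one_mul]; exact hW _ hs⟩
  | @cons s t a x ha hs hb _ ih =>
    obtain ⟨r, hr, hrun⟩ := ih
    refine ⟨a * (h c * r), ?_, ?_⟩
    · rw [LocalDivisor.conj_mul_val, hr, mul_assoc]
    · have := Run.of_block (W := {t | Run R V B h U (r * q) t}) hR hV hc hs hb hrun
      rw [mul_assoc, mul_assoc]
      refine this.append hB ?_
      rintro t' ⟨ht', t'', hR', hrun'⟩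
      exact .cons hcB ht' hR' hrun'

/-- The decomposition of a run at the occurrences of the letter `c`: either `c` does not occur, or
the run consists of a run without `c`, the letter `c`, a sequence of blocks ending in `c`, and a
run without `c`. -/
theorem run_iff_block [Fintype M] (hR : ∀ s t t', R s t → R s t' → t = t')
    (hV : ∀ a b s, s ∈ V a → s ∈ V b → a = b) (hc : c ∉ B') (hcB : c ∈ B)
    (hB : ∀ a, a ∈ B' ↔ a ≠ c ∧ a ∈ B) {m : M} {s : S} :
    Run R V B h U m s ↔ Run R V B' h U m s ∨
      ∃ (p : M) (x : LocalDivisor (h c)) (q : M), p * x.1 * q = m ∧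
        Run R V B' h (V c ∩ Next R {t | Run (Block R V B' c) (blockLetter R V B' h c) Finset.univ
          (LocalDivisor.conj (h c)) {t | Run R V B' h U q t} x t}) p s := by
  have hsub : B' ⊆ B := fun a ha => ((hB a).1 ha).2
  constructor
  · intro hs
    induction hs with
    | nil hs => exact .inl (.nil hs)
    | @cons s t a m ha hs hRt _ ih =>
      by_cases hac : a = c
      · subst hac
        right
        rcases ih with ih | ⟨p, x, q, rfl, ih⟩
        · refine ⟨1, 1, m, by rw [LocalDivisor.one_val, one_mul], .nil ⟨hs, t, hRt, .nil ih⟩⟩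
        · obtain ⟨hrun, t', hb, ht'⟩ := ih.exists_block
          refine ⟨1, LocalDivisor.conj (h a) p * x, q, ?_,
            .nil ⟨hs, t, hRt, .cons (Finset.mem_univ p) hrun hb ht'⟩⟩
          simp only [LocalDivisor.conj_mul_val, one_mul, mul_assoc]
      · rcases ih with ih | ⟨p, x, q, rfl, ih⟩
        · exact .inl (.cons ((hB a).2 ⟨hac, ha⟩) hs hRt ih)
        · refine .inr ⟨h a * p, x, q, by simp only [mul_assoc], ?_⟩
          exact .cons ((hB a).2 ⟨hac, ha⟩) hs hRt ih
  · rintro (hs | ⟨p, x, q, rfl, hs⟩)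
    · have := hs.append (q := 1) (U := U) hsub fun t ht => .nil ht
      rwa [mul_one] at this
    · rw [mul_assoc]
      refine hs.append hsub ?_
      rintro t ⟨ht, t', hRt, hrun⟩
      obtain ⟨r, hr, hrun'⟩ := exists_run_of_run_block (U := U) (q := q) hR hV hc hcB hsub hrun
        fun t ht => by
          have := Run.append (q := 1) (U := U) hsub ht fun t ht => .nil ht
          rwa [mul_one] at this
      rw [hr, mul_assoc]
      exact .cons hcB ht hRt hrun'

end Runs

/-- A family closed under next and until is closed under runs whose value in a finite aperiodic
monoid is prescribed. The induction is on the size of the monoid and then on the alphabet: a letter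
`c` of nontrivial value is removed from the alphabet, and the blocks between its occurrences form
words over a new alphabet, evaluated in the smaller local divisor at the value of `c`. The family
is closed under next and until along blocks as well, so that the induction applies to them. -/
theorem TemporallyClosed.run_mem {S : Type*} {𝒟 : Set (Set S)} {R : S → S → Prop} {A M : Type}
    [Monoid M] [Finite M] (h𝒟 : TemporallyClosed R 𝒟) (hM : IsAperiodic M)
    (hR : ∀ s t t', R s t → R s t' → t = t') {V : A → Set S} (hV𝒟 : ∀ a, V a ∈ 𝒟)
    (hV : ∀ a b s, s ∈ V a → s ∈ V b → a = b) (B : Finset A) (h : A → M) {U : Set S}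
    (hU : U ∈ 𝒟) (m : M) : {s | Run R V B h U m s} ∈ 𝒟 := by
  classical
  induction hn : Nat.card M using Nat.strong_induction_on generalizing A M R U with
  | _ n ihn =>
  induction B using Finset.strongInduction generalizing U m with
  | H B ihB =>
  by_cases h1 : ∀ a ∈ B, h a = 1
  · simp only [run_iff_of_forall_eq_one h1]
    exact h𝒟.setOf_and fun _ => h𝒟.untl (h𝒟.biUnion B fun a _ => hV𝒟 a) hU
  · push Not at h1
    obtain ⟨c, hcB, hc1⟩ := h1
    have hc : c ∉ B.erase c := Finset.notMem_erase c B
    have hlt : B.erase c ⊂ B := Finset.erase_ssubset hcB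
    have := Fintype.ofFinite M
    simp only [run_iff_block hR hV hc hcB fun a => Finset.mem_erase]
    refine h𝒟.union (ihB _ hlt hU m) ?_
    refine h𝒟.setOf_exists fun p => h𝒟.setOf_exists fun x => h𝒟.setOf_exists fun q =>
      h𝒟.setOf_and fun _ => ihB _ hlt (h𝒟.inter (hV𝒟 c) (h𝒟.next ?_)) p
    exact ihn _ (hn ▸ LocalDivisor.card_lt hM hc1) (h𝒟.block hR hV𝒟) (LocalDivisor.isAperiodic hM)
      (Block.target_unique hR hV hc) (fun a => ihB _ hlt (hV𝒟 c) a)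
      (fun a b s ha hb => Run.value_unique hR hV hc ha hb) _ _ (ihB _ hlt hU q) x rfl

/-! ### Recognition of first-order formulas over finite prefixes -/

/-- The product of the first `n` values of a sequence. -/
def prefixProd {M : Type*} [Monoid M] (f : ℕ → M) (n : ℕ) : M := ((List.range n).map f).prod

section PrefixProd

variable {M : Type*} [Monoid M]

theorem prefixProd_zero (f : ℕ → M) : prefixProd f 0 = 1 := rfl

theorem prefixProd_succ (f : ℕ → M) (n : ℕ) : prefixProd f (n + 1) = prefixProd f n * f n :=
  List.prod_range_succ f n

theorem prefixProd_succ' (f : ℕ → M) (n : ℕ) :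
    prefixProd f (n + 1) = f 0 * prefixProd (fun i => f (i + 1)) n :=
  List.prod_range_succ' f n

theorem prefixProd_congr {f g : ℕ → M} {n : ℕ} (h : ∀ i < n, f i = g i) :
    prefixProd f n = prefixProd g n := by
  induction n with
  | zero => rfl
  | succ n ih =>
    rw [prefixProd_succ, prefixProd_succ, ih fun i hi => h i (hi.trans n.lt_succ_self),
      h n n.lt_succ_self]

theorem prefixProd_prod {N : Type*} [Monoid N] (f : ℕ → M) (g : ℕ → N) (n : ℕ) :
    prefixProd (fun i => (f i, g i)) n = (prefixProd f n, prefixProd g n) := by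
  induction n with
  | zero => rfl
  | succ n ih => simp only [prefixProd_succ, ih, Prod.mk_mul_mk]

end PrefixProd

/-- The monoid that recognises the projection of a language recognised by `M`: along a word it
computes the value in `M` of the unmarked word and the set of the values of the words with one
marked position. -/
@[ext]
structure MarkedProduct (M : Type*) where
  /-- The value of the unmarked word. -/
  plain : M
  /-- The values of the words with one marked position. -/
  marked : Set M

namespace MarkedProduct

variable {M : Type*} [Monoid M]

instance : Mul (MarkedProduct M) where
  mul x y := ⟨x.plain * y.plain,
    {u | (∃ z ∈ x.marked, u = z * y.plain) ∨ ∃ z ∈ y.marked, u = x.plain * z}⟩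

instance : One (MarkedProduct M) where
  one := ⟨1, ∅⟩

theorem one_plain : (1 : MarkedProduct M).plain = 1 := rfl

theorem one_marked : (1 : MarkedProduct M).marked = ∅ := rfl

theorem mul_plain (x y : MarkedProduct M) : (x * y).plain = x.plain * y.plain := rfl

theorem mem_mul_marked {x y : MarkedProduct M} {u : M} : u ∈ (x * y).marked ↔
    (∃ z ∈ x.marked, u = z * y.plain) ∨ ∃ z ∈ y.marked, u = x.plain * z := Iff.rfl

instance : Monoid (MarkedProduct M) where
  mul_assoc x y z := by
    ext u
    · simp only [mul_plain, mul_assoc]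
    · simp only [mem_mul_marked, mul_plain]
      constructor
      · rintro (⟨_, ⟨v, hv, rfl⟩ | ⟨v, hv, rfl⟩, rfl⟩ | ⟨v, hv, rfl⟩)
        · exact .inl ⟨v, hv, mul_assoc _ _ _⟩
        · exact .inr ⟨_, .inl ⟨v, hv, rfl⟩, mul_assoc _ _ _⟩
        · exact .inr ⟨_, .inr ⟨v, hv, rfl⟩, mul_assoc _ _ _⟩
      · rintro (⟨v, hv, rfl⟩ | ⟨_, ⟨v, hv, rfl⟩ | ⟨v, hv, rfl⟩, rfl⟩)
        · exact .inl ⟨_, .inl ⟨v, hv, rfl⟩, (mul_assoc _ _ _).symm⟩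
        · exact .inl ⟨_, .inr ⟨v, hv, rfl⟩, (mul_assoc _ _ _).symm⟩
        · exact .inr ⟨v, hv, (mul_assoc _ _ _).symm⟩
  one_mul x := by
    ext u
    · simp [mul_plain, one_plain]
    · simp [mem_mul_marked, one_plain, one_marked]
  mul_one x := by
    ext u
    · simp [mul_plain, one_plain]
    · simp [mem_mul_marked, one_plain, one_marked]

instance [Finite M] : Finite (MarkedProduct M) :=
  Finite.of_injective (fun x : MarkedProduct M => (x.plain, x.marked)) fun x y h => by
    obtain ⟨h₁, h₂⟩ := Prod.mk.inj h
    exact MarkedProduct.ext h₁ h₂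

theorem pow_plain (x : MarkedProduct M) (n : ℕ) : (x ^ n).plain = x.plain ^ n := by
  induction n with
  | zero => simp [one_plain]
  | succ n ih => rw [pow_succ, pow_succ, mul_plain, ih]

theorem mem_pow_marked (x : MarkedProduct M) (n : ℕ) (u : M) : u ∈ (x ^ n).marked ↔
    ∃ i j, i + j + 1 = n ∧ ∃ z ∈ x.marked, u = x.plain ^ i * z * x.plain ^ j := by
  induction n generalizing u with
  | zero => simp [one_marked]
  | succ n ih =>
    rw [pow_succ, mem_mul_marked]
    simp only [ih, pow_plain]
    constructor
    · rintro (⟨_, ⟨i, j, hij, z, hz, rfl⟩, rfl⟩ | ⟨z, hz, rfl⟩)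
      · exact ⟨i, j + 1, by omega, z, hz, by rw [pow_succ, mul_assoc _ _ x.plain]⟩
      · exact ⟨n, 0, rfl, z, hz, by simp⟩
    · rintro ⟨i, j, hij, z, hz, rfl⟩
      cases j with
      | zero =>
        obtain rfl : i = n := by omega
        exact .inr ⟨z, hz, by simp⟩
      | succ j =>
        exact .inl ⟨_, ⟨i, j, by omega, z, hz, rfl⟩, by rw [pow_succ, mul_assoc _ _ x.plain]⟩

/-- If the powers of `x` are constant from exponent `n` on, then in a product `xⁱzxʲ` with
`i + j ≥ 2n` one of the two exponents can be changed without effect. -/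
theorem isAperiodic (hM : IsAperiodic M) : IsAperiodic (MarkedProduct M) := by
  intro x
  obtain ⟨n, hn⟩ := hM x.plain
  refine ⟨2 * n + 1, ?_⟩
  ext u
  · rw [pow_plain, pow_plain, pow_eq_pow_of_succ hn (by omega)]
  · simp only [mem_pow_marked]
    constructor
    · rintro ⟨i, j, hij, z, hz, rfl⟩
      by_cases hi : n + 1 ≤ i
      · obtain ⟨i, rfl⟩ : ∃ k, i = k + 1 := ⟨i - 1, by omega⟩
        exact ⟨i, j, by omega, z, hz, by rw [pow_eq_pow_of_succ hn (by omega)]⟩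
      · obtain ⟨j, rfl⟩ : ∃ k, j = k + 1 := ⟨j - 1, by omega⟩
        exact ⟨i, j, by omega, z, hz, by rw [pow_eq_pow_of_succ (k := j) hn (by omega)]⟩
    · rintro ⟨i, j, hij, z, hz, rfl⟩
      by_cases hi : n ≤ i
      · exact ⟨i + 1, j, by omega, z, hz, by rw [pow_eq_pow_of_succ hn hi]⟩
      · exact ⟨i, j + 1, by omega, z, hz, by rw [pow_eq_pow_of_succ (k := j) hn (by omega)]⟩

theorem prefixProd_plain (f g : ℕ → M) (n : ℕ) :
    (prefixProd (fun i => (⟨f i, {g i}⟩ : MarkedProduct M)) n).plain = prefixProd f n := by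
  induction n with
  | zero => rfl
  | succ n ih => rw [prefixProd_succ, prefixProd_succ, mul_plain, ih]

theorem mem_prefixProd_marked (f g : ℕ → M) (n : ℕ) (u : M) :
    u ∈ (prefixProd (fun i => (⟨f i, {g i}⟩ : MarkedProduct M)) n).marked ↔
      ∃ j < n, u = prefixProd (fun i => if i = j then g i else f i) n := by
  induction n generalizing u with
  | zero => simp [prefixProd_zero, one_marked]
  | succ n ih =>
    rw [prefixProd_succ, mem_mul_marked]
    simp only [ih, prefixProd_plain, Set.mem_singleton_iff, exists_eq_left]
    have hlast : prefixProd (fun i => if i = n then g i else f i) (n + 1)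
        = prefixProd f n * g n := by
      rw [prefixProd_succ, if_pos rfl,
        prefixProd_congr (g := f) fun i hi => if_neg hi.ne]
    have hinit : ∀ j < n, prefixProd (fun i => if i = j then g i else f i) (n + 1)
        = prefixProd (fun i => if i = j then g i else f i) n * f n := by
      intro j hj
      rw [prefixProd_succ, if_neg hj.ne']
    constructor
    · rintro (⟨_, ⟨j, hj, rfl⟩, rfl⟩ | rfl)
      · exact ⟨j, by omega, (hinit j hj).symm⟩
      · exact ⟨n, by omega, hlast.symm⟩
    · rintro ⟨j, hj, rfl⟩
      rcases Nat.lt_succ_iff_lt_or_eq.1 hj with hj | rfl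
      · exact .inl ⟨_, ⟨j, hj, rfl⟩, hinit j hj⟩
      · exact .inr hlast

end MarkedProduct

/-- The monoid that detects occurrences of two kinds of positions, and whether some position of the
first kind strictly precedes some position of the second kind. -/
@[ext]
structure Precedence where
  /-- A position of the first kind occurs. -/
  fst : Prop
  /-- A position of the second kind occurs. -/
  snd : Prop
  /-- A position of the first kind occurs before one of the second kind. -/
  ordered : Prop

namespace Precedence

instance : Mul Precedence where
  mul x y := ⟨x.fst ∨ y.fst, x.snd ∨ y.snd, x.ordered ∨ y.ordered ∨ x.fst ∧ y.snd⟩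

instance : One Precedence where
  one := ⟨False, False, False⟩

theorem one_def : (1 : Precedence) = ⟨False, False, False⟩ := rfl

theorem mul_def (x y : Precedence) : x * y =
    ⟨x.fst ∨ y.fst, x.snd ∨ y.snd, x.ordered ∨ y.ordered ∨ x.fst ∧ y.snd⟩ := rfl

instance : Monoid Precedence where
  mul_assoc x y z := by ext <;> simp only [mul_def] <;> tauto
  one_mul x := by ext <;> simp [mul_def, one_def]
  mul_one x := by ext <;> simp [mul_def, one_def]

instance : Finite Precedence :=
  Finite.of_injective (fun x : Precedence => (x.fst, x.snd, x.ordered)) fun x y h => by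
    simp only [Prod.mk.injEq] at h
    exact Precedence.ext h.1 h.2.1 h.2.2

theorem isAperiodic : IsAperiodic Precedence := by
  intro x
  refine ⟨2, ?_⟩
  simp only [pow_succ, pow_zero, one_mul]
  ext <;> simp only [mul_def] <;> tauto

theorem prefixProd_eq (α β : ℕ → Prop) (n : ℕ) :
    prefixProd (fun i => (⟨α i, β i, False⟩ : Precedence)) n =
      ⟨∃ i < n, α i, ∃ j < n, β j, ∃ i j, i < j ∧ j < n ∧ α i ∧ β j⟩ := by
  induction n with
  | zero => simp [prefixProd_zero, one_def]
  | succ n ih =>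
    rw [prefixProd_succ, ih, mul_def]
    ext
    · simp only [Nat.lt_succ_iff_lt_or_eq, or_and_right, exists_or, exists_eq_left]
    · simp only [Nat.lt_succ_iff_lt_or_eq, or_and_right, exists_or, exists_eq_left]
    · simp only [false_or]
      constructor
      · rintro (⟨i, j, hij, hj, h⟩ | ⟨⟨i, hi, hα⟩, hβ⟩)
        · exact ⟨i, j, hij, by omega, h⟩
        · exact ⟨i, n, hi, by omega, hα, hβ⟩
      · rintro ⟨i, j, hij, hj, hα, hβ⟩
        rcases Nat.lt_succ_iff_lt_or_eq.1 hj with hj | rfl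
        · exact .inl ⟨i, j, hij, hj, hα, hβ⟩
        · exact .inr ⟨⟨i, hij, hα⟩, hβ⟩

end Precedence

namespace FO

variable {P : Type u}

/-- Satisfaction in the prefix of length `N` of the word `σ`: the quantifiers range over the
positions less than `N`. -/
def BoundedSat (σ : StateSeq P) (N : ℕ) : (ℕ → ℕ) → FO P → Prop
  | v, lt x y => v x < v y
  | v, eq x y => v x = v y
  | v, pred p x => p ∈ σ (v x)
  | v, neg φ => ¬ BoundedSat σ N v φ
  | v, or φ ψ => BoundedSat σ N v φ ∨ BoundedSat σ N v ψ
  | v, and φ ψ => BoundedSat σ N v φ ∧ BoundedSat σ N v ψ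
  | v, imp φ ψ => BoundedSat σ N v φ → BoundedSat σ N v ψ
  | v, ex y φ => ∃ n < N, BoundedSat σ N (Function.update v y n) φ
  | v, all y φ => ∀ n < N, BoundedSat σ N (Function.update v y n) φ

/-- A condition on prefixes of words, with an assignment of positions to the variables, is
recognisable if it depends on a product in a finite aperiodic monoid. The factor of a position
depends on its letter, of which only finitely many propositions matter, and on the set of the
variables that are assigned to the position. -/
def Recognisable (T : StateSeq P → ℕ → (ℕ → ℕ) → Prop) : Prop :=
  ∃ (M : Type) (_ : Monoid M) (_ : Finite M) (Q : Finset P) (h : Set P → Set ℕ → M) (F : Set M),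
    IsAperiodic M ∧ (∀ a b X, (∀ p ∈ Q, p ∈ a ↔ p ∈ b) → h a X = h b X) ∧
      ∀ σ N v, (∀ x, v x < N) →
        (T σ N v ↔ prefixProd (fun i => h (σ i) {x | v x = i}) N ∈ F)

variable {T T' : StateSeq P → ℕ → (ℕ → ℕ) → Prop}

theorem Recognisable.congr (hT : Recognisable T)
    (h : ∀ σ N v, (∀ x, v x < N) → (T' σ N v ↔ T σ N v)) : Recognisable T' := by
  obtain ⟨M, _, _, Q, g, F, hM, hQ, hF⟩ := hT
  exact ⟨M, _, ‹_›, Q, g, F, hM, hQ, fun σ N v hv => (h σ N v hv).trans (hF σ N v hv)⟩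

theorem Recognisable.not (hT : Recognisable T) : Recognisable fun σ N v => ¬ T σ N v := by
  obtain ⟨M, _, _, Q, g, F, hM, hQ, hF⟩ := hT
  exact ⟨M, _, ‹_›, Q, g, Fᶜ, hM, hQ, fun σ N v hv => not_congr (hF σ N v hv)⟩

theorem Recognisable.or (hT : Recognisable T) (hT' : Recognisable T') :
    Recognisable fun σ N v => T σ N v ∨ T' σ N v := by
  classical
  obtain ⟨M, _, _, Q, g, F, hM, hQ, hF⟩ := hT
  obtain ⟨M', _, _, Q', g', F', hM', hQ', hF'⟩ := hT'
  refine ⟨M × M', inferInstance, inferInstance, Q ∪ Q', fun a X => (g a X, g' a X),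
    {x | x.1 ∈ F ∨ x.2 ∈ F'}, hM.prod hM', ?_, ?_⟩
  · intro a b X hab
    beta_reduce
    rw [hQ a b X fun p hp => hab p (Finset.mem_union_left _ hp),
      hQ' a b X fun p hp => hab p (Finset.mem_union_right _ hp)]
  · intro σ N v hv
    beta_reduce
    rw [prefixProd_prod, hF σ N v hv, hF' σ N v hv]
    rfl

theorem Recognisable.exists_lt (hT : Recognisable T) (y : ℕ) :
    Recognisable fun σ N v => ∃ n < N, T σ N (Function.update v y n) := by
  obtain ⟨M, _, _, Q, g, F, hM, hQ, hF⟩ := hT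
  refine ⟨MarkedProduct M, inferInstance, inferInstance, Q,
    fun a X => ⟨g a (X \ {y}), {g a (insert y X)}⟩, {x | ∃ u ∈ x.marked, u ∈ F},
    MarkedProduct.isAperiodic hM, ?_, ?_⟩
  · intro a b X hab
    beta_reduce
    rw [hQ a b _ hab, hQ a b _ hab]
  · intro σ N v hv
    have hprod : ∀ n, prefixProd (fun i => if i = n then g (σ i) (insert y {x | v x = i})
        else g (σ i) ({x | v x = i} \ {y})) N =
        prefixProd (fun i => g (σ i) {x | Function.update v y n x = i}) N := by
      intro n
      refine prefixProd_congr fun i _ => ?_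
      split_ifs with hi
      · congr 1
        ext x
        by_cases hx : x = y <;> simp [Function.update_apply, hx, hi]
      · congr 1
        ext x
        by_cases hx : x = y <;> simp [Function.update_apply, hx, Ne.symm hi]
    have hupd : ∀ n < N, ∀ x, Function.update v y n x < N := by
      intro n hn x
      rw [Function.update_apply]
      split_ifs
      exacts [hn, hv x]
    simp only [Set.mem_ofPred_eq, MarkedProduct.mem_prefixProd_marked, hprod]
    constructor
    · rintro ⟨n, hn, hT⟩
      exact ⟨_, ⟨n, hn, rfl⟩, (hF σ N _ (hupd n hn)).1 hT⟩
    · rintro ⟨_, ⟨n, hn, rfl⟩, hT⟩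
      exact ⟨n, hn, (hF σ N _ (hupd n hn)).2 hT⟩

theorem recognisable_lt (x y : ℕ) : Recognisable fun (_ : StateSeq P) _ v => v x < v y := by
  refine ⟨Precedence, inferInstance, inferInstance, ∅, fun _ X => ⟨x ∈ X, y ∈ X, False⟩,
    {e | e.ordered}, Precedence.isAperiodic, fun _ _ _ _ => rfl, ?_⟩
  intro σ N v hv
  rw [Precedence.prefixProd_eq]
  constructor
  · intro h
    exact ⟨v x, v y, h, hv y, rfl, rfl⟩
  · rintro ⟨_, _, h, _, rfl, rfl⟩
    exact h

theorem recognisable_pred (p : P) (x : ℕ) :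
    Recognisable fun (σ : StateSeq P) _ v => p ∈ σ (v x) := by
  refine ⟨Precedence, inferInstance, inferInstance, {p},
    fun a X => ⟨p ∈ a ∧ x ∈ X, False, False⟩, {e | e.fst}, Precedence.isAperiodic, ?_, ?_⟩
  · intro a b X hab
    beta_reduce
    rw [hab p (Finset.mem_singleton_self p)]
  · intro σ N v hv
    rw [Precedence.prefixProd_eq (fun i => p ∈ σ i ∧ x ∈ {x | v x = i}) fun _ => False]
    constructor
    · intro h
      exact ⟨v x, hv x, h, rfl⟩
    · rintro ⟨_, _, h, rfl⟩
      exact h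

/-- Over prefixes, every first-order formula is recognised by a finite aperiodic monoid. -/
theorem recognisable_boundedSat (φ : FO P) : Recognisable fun σ N v => BoundedSat σ N v φ := by
  induction φ with
  | lt x y => exact recognisable_lt x y
  | eq x y =>
    refine ((recognisable_lt x y).or (recognisable_lt y x)).not.congr fun σ N v _ => ?_
    simp only [BoundedSat]
    omega
  | pred p x => exact recognisable_pred p x
  | neg φ ih => exact ih.not
  | or φ ψ ihφ ihψ => exact ihφ.or ihψ
  | and φ ψ ihφ ihψ =>
    refine (ihφ.not.or ihψ.not).not.congr fun σ N v _ => ?_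
    simp only [BoundedSat]
    tauto
  | imp φ ψ ihφ ihψ =>
    refine (ihφ.not.or ihψ).congr fun σ N v _ => ?_
    simp only [BoundedSat]
    tauto
  | ex y φ ih => exact ih.exists_lt y
  | all y φ ih =>
    refine (ih.not.exists_lt y).not.congr fun σ N v _ => ?_
    simp only [BoundedSat]
    push Not
    rfl

/-! ### Co-safety formulas are decided by prefixes -/

theorem IsAtomic.boundedSat_iff {φ : FO P} (hφ : IsAtomic φ) (σ : StateSeq P) (N : ℕ)
    (v : ℕ → ℕ) : BoundedSat σ N v φ ↔ Sat σ v φ := by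
  cases hφ <;> rfl

/-- A satisfied co-safety formula is satisfied in all sufficiently long prefixes, since a bounded
universal quantifier imposes only finitely many conditions. -/
theorem IsCoSafety.eventually_boundedSat {φ : FO P} (hφ : IsCoSafety φ) {σ : StateSeq P}
    {v : ℕ → ℕ} (h : Sat σ v φ) : ∀ᶠ N in Filter.atTop, BoundedSat σ N v φ := by
  induction hφ generalizing v with
  | atomic hφ => exact .of_forall fun N => (hφ.boundedSat_iff σ N v).2 h
  | or _ _ ihφ ihψ =>
    rcases h with h | h
    · exact (ihφ h).mono fun N hN => .inl hN
    · exact (ihψ h).mono fun N hN => .inr hN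
  | and _ _ ihφ ihψ => exact (ihφ h.1).and (ihψ h.2)
  | ex _ _ ih =>
    obtain ⟨n, hlt, hn⟩ := h
    filter_upwards [ih hn, Filter.eventually_gt_atTop n] with N hN hnN
    exact ⟨n, hnN, hlt, hN⟩
  | @all x y z φ hx hz _ ih =>
    -- The guard leaves only the finitely many values of `y` below that of `z`.
    have key : ∀ n ∈ Set.Iio (v z), ∀ᶠ N in Filter.atTop,
        v x < n → BoundedSat σ N (Function.update v y n) φ := by
      intro n hn
      by_cases hxn : v x < n
      · have := h n ⟨by simpa [Sat, hx] using hxn, by simpa [Sat, hz] using hn⟩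
        exact (ih this).mono fun N hN _ => hN
      · exact .of_forall fun N h => absurd h hxn
    filter_upwards [((Set.finite_Iio (v z)).eventually_all).2 key] with N hN n _ hguard
    simp only [BoundedSat, Function.update_self, Function.update_of_ne hx,
      Function.update_of_ne hz] at hguard
    exact hN n hguard.2 hguard.1

/-- Satisfaction in a prefix persists, since universally quantified variables are bounded by
positions in the prefix. -/
theorem IsCoSafety.sat_of_boundedSat {φ : FO P} (hφ : IsCoSafety φ) {σ : StateSeq P} {N : ℕ}
    {v : ℕ → ℕ} (hv : ∀ x, v x < N) (h : BoundedSat σ N v φ) : Sat σ v φ := by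
  have hupd : ∀ (v : ℕ → ℕ) (y n : ℕ), (∀ x, v x < N) → n < N →
      ∀ x, Function.update v y n x < N := by
    intro v y n hv hn x
    rw [Function.update_apply]
    split_ifs
    exacts [hn, hv x]
  induction hφ generalizing v with
  | atomic hφ => exact (hφ.boundedSat_iff σ N v).1 h
  | or _ _ ihφ ihψ => exact h.imp (ihφ hv) (ihψ hv)
  | and _ _ ihφ ihψ => exact ⟨ihφ hv h.1, ihψ hv h.2⟩
  | ex _ _ ih =>
    obtain ⟨n, hn, hlt, h⟩ := h
    exact ⟨n, hlt, ih (hupd v _ n hv hn) h⟩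
  | @all x y z φ hx hz _ ih =>
    intro n hguard
    have hn : n < N := by
      have := hguard.2
      simp only [Sat, Function.update_self, Function.update_of_ne hz] at this
      exact this.trans (hv z)
    exact ih (hupd v y n hv hn) (h n hn hguard)

theorem IsCoSafety.sat_iff_exists_boundedSat {φ : FO P} (hφ : IsCoSafety φ) (σ : StateSeq P) :
    Sat σ (fun _ => 0) φ ↔ ∃ n, BoundedSat σ (n + 1) (fun _ => 0) φ := by
  constructor
  · intro h
    obtain ⟨N, hN, hpos⟩ :=
      ((hφ.eventually_boundedSat h).and (Filter.eventually_gt_atTop 0)).exists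
    exact ⟨N - 1, by rwa [Nat.sub_add_cancel hpos]⟩
  · rintro ⟨n, hn⟩
    exact hφ.sat_of_boundedSat (fun _ => n.succ_pos) hn

end FO

/-! ### From coSafetyFO to coSafetyLTL -/

/-- The suffix relation: the second word is the first one without its first letter. -/
def IsTail {P : Type u} (σ τ : StateSeq P) : Prop := τ = fun i => σ (i + 1)

namespace LTL

variable {P : Type u}

theorem sat_iff_sat_suffix (φ : LTL P) (σ : StateSeq P) (i : ℕ) :
    Sat σ i φ ↔ Sat (fun k => σ (i + k)) 0 φ := by
  suffices h : ∀ i j, Sat σ (i + j) φ ↔ Sat (fun k => σ (i + k)) j φ from h i 0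
  clear i
  intro i j
  induction φ generalizing j with
  | letter p => rfl
  | neg φ ih => exact not_congr (ih j)
  | or φ ψ ihφ ihψ => exact or_congr (ihφ j) (ihψ j)
  | and φ ψ ihφ ihψ => exact and_congr (ihφ j) (ihψ j)
  | next φ ih => exact ih (j + 1)
  | wnext φ ih => exact ih (j + 1)
  | untl φ ψ ihφ ihψ =>
    simp only [Sat, ← ihφ, ← ihψ]
    constructor
    · rintro ⟨k, hk, h, h'⟩
      obtain ⟨d, rfl⟩ := Nat.exists_eq_add_of_le hk
      exact ⟨j + d, by omega, by rwa [← add_assoc], fun l hl hl' => h' _ (by omega) (by omega)⟩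
    · rintro ⟨k, hk, h, h'⟩
      refine ⟨i + k, by omega, h, fun l hl hl' => ?_⟩
      obtain ⟨d, rfl⟩ := Nat.exists_eq_add_of_le (show i ≤ l by omega)
      exact h' d (by omega) (by omega)
  | release φ ψ ihφ ihψ =>
    simp only [Sat, ← ihφ, ← ihψ]
    refine or_congr ?_ ?_
    · constructor
      · intro h k hk
        exact h _ (by omega)
      · intro h k hk
        obtain ⟨d, rfl⟩ := Nat.exists_eq_add_of_le (show i ≤ k by omega)
        exact h d (by omega)
    · constructor
      · rintro ⟨k, hk, h, h'⟩
        obtain ⟨d, rfl⟩ := Nat.exists_eq_add_of_le (show i ≤ k by omega)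
        exact ⟨d, by omega, h, fun l hl hl' => h' _ (by omega) (by omega)⟩
      · rintro ⟨k, hk, h, h'⟩
        refine ⟨i + k, by omega, h, fun l hl hl' => ?_⟩
        obtain ⟨d, rfl⟩ := Nat.exists_eq_add_of_le (show i ≤ l by omega)
        exact h' d (by omega) (by omega)

theorem mem_language_tail (φ : LTL P) (σ : StateSeq P) :
    (fun i => σ (i + 1)) ∈ φ.language ↔ Sat σ 1 φ := by
  rw [sat_iff_sat_suffix φ σ 1]
  simp only [add_comm 1]
  rfl

theorem until_language_iff (φ ψ : LTL P) (σ : StateSeq P) :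
    Until IsTail φ.language ψ.language σ ↔ σ ∈ (untl φ ψ).language := by
  constructor
  · intro h
    induction h with
    | here h => exact ⟨0, le_rfl, h, fun k _ hk => absurd hk k.not_lt_zero⟩
    | @step σ τ h hR _ ih =>
      obtain rfl : τ = _ := hR
      rw [mem_language_tail] at ih
      obtain ⟨j, hj, hψ, hφ⟩ := ih
      refine ⟨j, j.zero_le, hψ, fun k _ hk => ?_⟩
      rcases Nat.eq_zero_or_pos k with rfl | hpos
      exacts [h, hφ k hpos hk]
  · rintro ⟨j, -, hψ, hφ⟩
    induction j generalizing σ with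
    | zero => exact .here hψ
    | succ j ih =>
      have hshift : ∀ (χ : LTL P) k, Sat (fun i => σ (i + 1)) k χ ↔ Sat σ (k + 1) χ := by
        intro χ k
        rw [sat_iff_sat_suffix, sat_iff_sat_suffix χ σ]
        simp only [add_right_comm]
      refine .step (hφ 0 le_rfl j.succ_pos) rfl (ih _ ((hshift _ _).2 hψ) fun k _ hk => ?_)
      exact (hshift _ _).2 (hφ (k + 1) (k + 1).zero_le (by omega))

theorem temporallyClosed_coSafety [Nonempty P] :
    TemporallyClosed IsTail (coSafetyLTLLanguages P) where
  empty := by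
    obtain ⟨p⟩ := ‹Nonempty P›
    refine ⟨and (letter p) (neg (letter p)), .and (.letter p) (.negLetter p), ?_⟩
    ext σ
    simp [language, Sat]
  union := by
    rintro _ _ ⟨φ, hφ, rfl⟩ ⟨ψ, hψ, rfl⟩
    exact ⟨or φ ψ, .or hφ hψ, rfl⟩
  inter := by
    rintro _ _ ⟨φ, hφ, rfl⟩ ⟨ψ, hψ, rfl⟩
    exact ⟨and φ ψ, .and hφ hψ, rfl⟩
  next := by
    rintro _ ⟨φ, hφ, rfl⟩
    refine ⟨next φ, .next hφ, ?_⟩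
    ext σ
    exact exists_eq_left.trans (mem_language_tail φ σ)
  untl := by
    rintro _ _ ⟨φ, hφ, rfl⟩ ⟨ψ, hψ, rfl⟩
    exact ⟨untl φ ψ, .untl hφ hψ, Set.ext fun σ => until_language_iff φ ψ σ⟩

theorem univ_mem_coSafety [Nonempty P] : Set.univ ∈ coSafetyLTLLanguages P := by
  obtain ⟨p⟩ := ‹Nonempty P›
  refine ⟨or (letter p) (neg (letter p)), .or (.letter p) (.negLetter p), ?_⟩
  ext σ
  simp [language, Sat, em]

/-- A condition on the first letter that depends on finitely many propositions is a Boolean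
combination of letters. -/
theorem setOf_head_mem_coSafety [Nonempty P] {q : Set P → Prop} (Q : Finset P)
    (hq : ∀ a b, (∀ p ∈ Q, p ∈ a ↔ p ∈ b) → (q a ↔ q b)) :
    {σ : StateSeq P | q (σ 0)} ∈ coSafetyLTLLanguages P := by
  classical
  have hcl := temporallyClosed_coSafety (P := P)
  induction Q using Finset.induction_on generalizing q with
  | empty =>
    by_cases h : q ∅
    · convert univ_mem_coSafety (P := P) using 1
      exact Set.eq_univ_of_forall fun σ => (hq ∅ _ (by simp)).1 h
    · convert hcl.empty using 1
      exact Set.eq_empty_of_forall_notMem fun σ hσ => h ((hq ∅ _ (by simp)).2 hσ)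
  | insert r Q hr ih =>
    have hpos := ih (q := fun a => q (insert r a)) fun a b hab => hq _ _ fun p hp => by
      rcases Finset.mem_insert.1 hp with rfl | hp
      · simp
      · simp [hab p hp]
    have hneg := ih (q := fun a => q (a \ {r})) fun a b hab => hq _ _ fun p hp => by
      rcases Finset.mem_insert.1 hp with rfl | hp
      · simp
      · simp [hab p hp]
    have hl : {σ : StateSeq P | r ∈ σ 0} ∈ coSafetyLTLLanguages P := ⟨letter r, .letter r, rfl⟩
    have hl' : {σ : StateSeq P | r ∉ σ 0} ∈ coSafetyLTLLanguages P :=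
      ⟨neg (letter r), .negLetter r, rfl⟩
    convert hcl.union (hcl.inter hl hpos) (hcl.inter hl' hneg) using 1
    ext σ
    by_cases hσ : r ∈ σ 0
    · simp [hσ, Set.insert_eq_of_mem hσ]
    · simp [hσ, Set.sdiff_singleton_eq_self hσ]

end LTL

/-- Runs along the suffix relation, with the values of the first letters as alphabet, compute the
values of prefixes. -/
theorem run_isTail_iff {P : Type u} {M : Type} [Monoid M] [Fintype M] (h : Set P → M) (m : M)
    (σ : StateSeq P) :
    Run IsTail (fun a => {τ : StateSeq P | h (τ 0) = a}) Finset.univ id Set.univ m σ ↔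
      ∃ n, prefixProd (fun i => h (σ i)) n = m := by
  constructor
  · intro hs
    induction hs with
    | nil => exact ⟨0, rfl⟩
    | @cons σ τ a m _ ha hR _ ih =>
      obtain rfl : τ = _ := hR
      obtain rfl : h (σ 0) = a := ha
      obtain ⟨n, hn⟩ := ih
      exact ⟨n + 1, by rw [prefixProd_succ', hn]; rfl⟩
  · rintro ⟨n, rfl⟩
    induction n generalizing σ with
    | zero => exact .nil trivial
    | succ n ih =>
      rw [prefixProd_succ']
      exact Run.cons (h := id) (Finset.mem_univ _) rfl rfl (ih fun i => σ (i + 1))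

theorem coSafetyFOLanguages_subset {P : Type u} [Nonempty P] :
    coSafetyFOLanguages P ⊆ coSafetyLTLLanguages P := by
  rintro _ ⟨φ, x, hφ, -, rfl⟩
  have hcl := LTL.temporallyClosed_coSafety (P := P)
  obtain ⟨M, _, _, Q, h, F, hM, hQ, hF⟩ := FO.recognisable_boundedSat φ
  have := Fintype.ofFinite M
  have hrun : ∀ m, {σ : StateSeq P | Run IsTail (fun a => {τ : StateSeq P | h (τ 0) ∅ = a})
      Finset.univ id Set.univ m σ} ∈ coSafetyLTLLanguages P := fun m =>
    hcl.run_mem (V := fun a => {τ : StateSeq P | h (τ 0) ∅ = a}) hM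
      (fun σ τ τ' hτ hτ' => hτ.trans hτ'.symm)
      (fun a => LTL.setOf_head_mem_coSafety (q := fun b => h b ∅ = a) Q fun b b' hb => by
        simp only [hQ b b' ∅ hb])
      (fun a b σ (ha : _ = a) (hb : _ = b) => ha.symm.trans hb) _ _ LTL.univ_mem_coSafety m
  -- All variables are assigned to position `0`, so the later positions carry no variable.
  have hlang : φ.language = {σ | ∃ a b : M, a * b ∈ F ∧
      σ ∈ {σ : StateSeq P | h (σ 0) Set.univ = a} ∩ Next IsTail {σ : StateSeq P |
        Run IsTail (fun a => {τ : StateSeq P | h (τ 0) ∅ = a}) Finset.univ id Set.univ b σ}} := by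
    ext σ
    simp only [run_isTail_iff (fun a => h a ∅), FO.language, Set.mem_ofPred_eq,
      hφ.sat_iff_exists_boundedSat]
    have hprod : ∀ n, FO.BoundedSat σ (n + 1) (fun _ => 0) φ ↔
        h (σ 0) Set.univ * prefixProd (fun i => h (σ (i + 1)) ∅) n ∈ F := by
      intro n
      refine (hF σ (n + 1) _ fun _ => n.succ_pos).trans ?_
      rw [prefixProd_succ']
      simp
    simp only [hprod]
    constructor
    · rintro ⟨n, hn⟩
      exact ⟨_, _, hn, rfl, _, rfl, n, rfl⟩
    · rintro ⟨_, _, hab, rfl, _, rfl, n, rfl⟩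
      exact ⟨n, hab⟩
  rw [hlang]
  refine hcl.setOf_exists fun a => hcl.setOf_exists fun b => hcl.setOf_and fun _ =>
    hcl.inter (LTL.setOf_head_mem_coSafety (q := fun c => h c Set.univ = a) Q
      fun c c' hc => by simp only [hQ c c' Set.univ hc])
      (hcl.next (hrun b))

/-! ### From coSafetyLTL to coSafetyFO -/

/-- The standard translation. The variables `x + 1` and `x + 2` serve as the bound variables, so the
variable `x` stays free. -/
theorem LTL.IsCoSafety.exists_fo {P : Type u} {φ : LTL P} (hφ : φ.IsCoSafety) (x : ℕ) :
    ∃ χ : FO P, χ.IsCoSafety ∧ χ.freeVars = {x} ∧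
      ∀ σ v, FO.Sat σ v χ ↔ LTL.Sat σ (v x) φ := by
  have hnext : ∀ φ : LTL P, (∀ x, ∃ χ : FO P, χ.IsCoSafety ∧ χ.freeVars = {x} ∧
      ∀ σ v, FO.Sat σ v χ ↔ LTL.Sat σ (v x) φ) → ∀ x, ∃ χ : FO P, χ.IsCoSafety ∧
      χ.freeVars = {x} ∧ ∀ σ v, FO.Sat σ v χ ↔ LTL.Sat σ (v x + 1) φ := by
    intro φ ih x
    obtain ⟨χ, hχ, hfree, hsat⟩ := ih (x + 1)
    -- The successor `x + 1` of `x` is the later position with no position in between.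
    refine ⟨.ex (x + 1) (.and (.lt x (x + 1)) (.and (.all (x + 2) (.imp (.and (.lt x (x + 2))
      (.lt (x + 2) (x + 1))) (.neg (.eq (x + 2) (x + 2))))) χ)),
      .ex (by omega) (.and (.all (by omega) (by omega) (.atomic (.ne _ _))) hχ), ?_, ?_⟩
    · ext z
      simp only [FO.freeVars, hfree, Finset.mem_erase, Finset.mem_union, Finset.mem_insert,
        Finset.mem_singleton]
      omega
    · intro σ v
      simp only [FO.Sat, hsat, Function.update_apply]
      simp only [Nat.left_eq_add, one_ne_zero, if_true, if_false,
        OfNat.ofNat_ne_zero, not_true_eq_false, Nat.add_left_cancel_iff, OfNat.one_ne_ofNat]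
      constructor
      · rintro ⟨n, hn, hall, h⟩
        obtain rfl : n = v x + 1 := by
          by_contra hne
          exact hall (v x + 1) ⟨by omega, by omega⟩
        exact h
      · intro h
        exact ⟨v x + 1, by omega, fun k hk => by omega, h⟩
  induction hφ generalizing x with
  | letter p => exact ⟨.pred p x, .atomic (.pred p x), rfl, fun _ _ => Iff.rfl⟩
  | negLetter p => exact ⟨.neg (.pred p x), .atomic (.negPred p x), rfl, fun _ _ => Iff.rfl⟩
  | or _ _ ihφ ihψ =>
    obtain ⟨χ, hχ, hfree, hsat⟩ := ihφ x
    obtain ⟨χ', hχ', hfree', hsat'⟩ := ihψ x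
    exact ⟨.or χ χ', .or hχ hχ', by simp [FO.freeVars, hfree, hfree'],
      fun σ v => or_congr (hsat σ v) (hsat' σ v)⟩
  | and _ _ ihφ ihψ =>
    obtain ⟨χ, hχ, hfree, hsat⟩ := ihφ x
    obtain ⟨χ', hχ', hfree', hsat'⟩ := ihψ x
    exact ⟨.and χ χ', .and hχ hχ', by simp [FO.freeVars, hfree, hfree'],
      fun σ v => and_congr (hsat σ v) (hsat' σ v)⟩
  | next _ ih => exact hnext _ ih x
  | wnext _ ih => exact hnext _ ih x
  | @untl φ ψ _ _ ihφ ihψ =>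
    obtain ⟨χ₀, hχ₀, hfree₀, hsat₀⟩ := ihφ x
    obtain ⟨χ₂, hχ₂, hfree₂, hsat₂⟩ := ihφ (x + 2)
    obtain ⟨θ₀, hθ₀, hfree₀', hsat₀'⟩ := ihψ x
    obtain ⟨θ₁, hθ₁, hfree₁', hsat₁'⟩ := ihψ (x + 1)
    refine ⟨.or θ₀ (.and χ₀ (.ex (x + 1) (.and (.lt x (x + 1)) (.and θ₁ (.all (x + 2)
      (.imp (.and (.lt x (x + 2)) (.lt (x + 2) (x + 1))) χ₂)))))),
      .or hθ₀ (.and hχ₀ (.ex (by omega) (.and hθ₁ (.all (by omega) (by omega) hχ₂)))), ?_, ?_⟩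
    · ext z
      simp only [FO.freeVars, hfree₀, hfree₂, hfree₀', hfree₁', Finset.mem_erase,
        Finset.mem_union, Finset.mem_insert, Finset.mem_singleton]
      omega
    · intro σ v
      simp only [FO.Sat, hsat₀, hsat₂, hsat₀', hsat₁', Function.update_apply]
      simp only [Nat.left_eq_add, one_ne_zero, if_true, if_false,
        OfNat.ofNat_ne_zero, Nat.add_left_cancel_iff, OfNat.one_ne_ofNat, LTL.Sat]
      constructor
      · rintro (h | ⟨h, n, hn, hψ, hall⟩)
        · exact ⟨v x, le_rfl, h, fun k _ _ => by omega⟩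
        · refine ⟨n, by omega, hψ, fun k hk hkn => ?_⟩
          rcases hk.eq_or_lt with rfl | hk
          exacts [h, hall k ⟨hk, hkn⟩]
      · rintro ⟨j, hj, hψ, hall⟩
        rcases hj.eq_or_lt with rfl | hj
        · exact .inl hψ
        · exact .inr ⟨hall _ le_rfl hj, j, hj, hψ, fun k hk => hall k hk.1.le hk.2⟩

theorem coSafetyLTLLanguages_eq {P : Type u} [Nonempty P] :
    coSafetyLTLLanguages P = coSafetyFOLanguages P := by
  refine subset_antisymm ?_ coSafetyFOLanguages_subset
  rintro _ ⟨φ, hφ, rfl⟩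
  obtain ⟨χ, hχ, hfree, hsat⟩ := hφ.exists_fo 0
  exact ⟨χ, 0, hχ, hfree, Set.ext fun σ => (hsat σ fun _ => 0).symm⟩

/-! ### Duality -/

namespace LTL

variable {P : Type u}

/-- Release is the dual of until. If the release formula holds although `ψ` does not hold forever,
the least position satisfying `φ` witnesses it. -/
theorem sat_release_iff (φ ψ : LTL P) (σ : StateSeq P) (i : ℕ) : Sat σ i (release φ ψ) ↔
    ¬ ∃ j, i ≤ j ∧ ¬ Sat σ j ψ ∧ ∀ k, i ≤ k → k < j → ¬ Sat σ k φ := by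
  classical
  simp only [Sat]
  constructor
  · rintro (h | ⟨k, hk, hφ, hψ⟩) ⟨j, hj, hj', hlt⟩
    · exact hj' (h j hj)
    · rcases lt_or_ge k j with hkj | hkj
      exacts [hlt k hk hkj hφ, hj' (hψ j hj hkj)]
  · intro h
    by_cases hex : ∃ k, i ≤ k ∧ Sat σ k φ
    · obtain ⟨hk, hφ⟩ := Nat.find_spec hex
      refine .inr ⟨Nat.find hex, hk, hφ, fun j hj hjk => by_contra fun hψ => h ⟨j, hj, hψ, ?_⟩⟩
      exact fun l hl hlj hφ' => Nat.find_min hex (hlj.trans_le hjk) ⟨hl, hφ'⟩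
    · exact .inl fun j hj => by_contra fun hψ =>
        h ⟨j, hj, hψ, fun k hk _ hφ => hex ⟨k, hk, hφ⟩⟩

/-- The negation of a formula, pushed inwards. Formulas in negated normal form are mapped to
formulas in negated normal form. -/
def dual : LTL P → LTL P
  | letter p => neg (letter p)
  | neg φ => φ
  | or φ ψ => and (dual φ) (dual ψ)
  | and φ ψ => or (dual φ) (dual ψ)
  | next φ => next (dual φ)
  | wnext φ => wnext (dual φ)
  | untl φ ψ => release (dual φ) (dual ψ)
  | release φ ψ => untl (dual φ) (dual ψ)

theorem sat_dual (φ : LTL P) (σ : StateSeq P) (i : ℕ) : Sat σ i φ.dual ↔ ¬ Sat σ i φ := by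
  induction φ generalizing i with
  | letter p => rfl
  | neg φ _ => exact not_not.symm
  | or φ ψ ihφ ihψ => simp only [dual, Sat, ihφ, ihψ, not_or]
  | and φ ψ ihφ ihψ => simp only [dual, Sat, ihφ, ihψ, not_and_or]
  | next φ ih => exact ih (i + 1)
  | wnext φ ih => exact ih (i + 1)
  | untl φ ψ ihφ ihψ => simp only [dual, sat_release_iff, ihφ, ihψ, not_not, Sat]
  | release φ ψ ihφ ihψ =>
    rw [sat_release_iff, not_not]
    simp only [dual, Sat, ihφ, ihψ]

theorem IsCoSafety.dual {φ : LTL P} (hφ : φ.IsCoSafety) : φ.dual.IsSafety := by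
  induction hφ with
  | letter p => exact .negLetter p
  | negLetter p => exact .letter p
  | or _ _ ihφ ihψ => exact .and ihφ ihψ
  | and _ _ ihφ ihψ => exact .or ihφ ihψ
  | next _ ih => exact .next ih
  | wnext _ ih => exact .wnext ih
  | untl _ _ ihφ ihψ => exact .release ihφ ihψ

theorem IsSafety.dual {φ : LTL P} (hφ : φ.IsSafety) : φ.dual.IsCoSafety := by
  induction hφ with
  | letter p => exact .negLetter p
  | negLetter p => exact .letter p
  | or _ _ ihφ ihψ => exact .and ihφ ihψ
  | and _ _ ihφ ihψ => exact .or ihφ ihψ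
  | next _ ih => exact .next ih
  | wnext _ ih => exact .wnext ih
  | release _ _ ihφ ihψ => exact .untl ihφ ihψ

theorem language_dual (φ : LTL P) : φ.dual.language = φ.languageᶜ :=
  Set.ext fun σ => sat_dual φ σ 0

theorem mem_safetyLTLLanguages_iff {L : Set (StateSeq P)} :
    L ∈ safetyLTLLanguages P ↔ Lᶜ ∈ coSafetyLTLLanguages P := by
  constructor
  · rintro ⟨φ, hφ, rfl⟩
    exact ⟨φ.dual, hφ.dual, (language_dual φ).symm⟩
  · rintro ⟨φ, hφ, h⟩
    exact ⟨φ.dual, hφ.dual, by rw [language_dual, ← h, compl_compl]⟩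

end LTL

namespace FO

variable {P : Type u}

/-- The negation of `x < y` is not atomic, but the atoms `y < x` and `x = y` express it. -/
theorem IsAtomic.exists_dual {φ : FO P} (hφ : IsAtomic φ) : ∃ χ : FO P, χ.IsCoSafety ∧
    χ.IsSafety ∧ χ.freeVars = φ.freeVars ∧ ∀ σ v, Sat σ v χ ↔ ¬ Sat σ v φ := by
  cases hφ with
  | lt x y =>
    refine ⟨.or (.lt y x) (.eq x y), .or (.atomic (.lt y x)) (.atomic (.eq x y)),
      .or (.atomic (.lt y x)) (.atomic (.eq x y)), ?_, fun σ v => ?_⟩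
    · ext z
      simp only [freeVars, Finset.mem_union, Finset.mem_insert, Finset.mem_singleton]
      tauto
    · simp only [Sat]
      omega
  | eq x y => exact ⟨.neg (.eq x y), .atomic (.ne x y), .atomic (.ne x y), rfl, fun _ _ => Iff.rfl⟩
  | ne x y =>
    exact ⟨.eq x y, .atomic (.eq x y), .atomic (.eq x y), rfl, fun _ _ => not_not.symm⟩
  | pred p x =>
    exact ⟨.neg (.pred p x), .atomic (.negPred p x), .atomic (.negPred p x), rfl,
      fun _ _ => Iff.rfl⟩
  | negPred p x =>
    exact ⟨.pred p x, .atomic (.pred p x), .atomic (.pred p x), rfl, fun _ _ => not_not.symm⟩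

theorem IsCoSafety.exists_dual {φ : FO P} (hφ : IsCoSafety φ) : ∃ χ : FO P,
    χ.IsSafety ∧ χ.freeVars = φ.freeVars ∧ ∀ σ v, Sat σ v χ ↔ ¬ Sat σ v φ := by
  induction hφ with
  | atomic hφ =>
    obtain ⟨χ, -, h⟩ := hφ.exists_dual
    exact ⟨χ, h⟩
  | or _ _ ihφ ihψ =>
    obtain ⟨χ, hχ, hfree, hsat⟩ := ihφ
    obtain ⟨χ', hχ', hfree', hsat'⟩ := ihψ
    exact ⟨.and χ χ', .and hχ hχ', by simp only [freeVars, hfree, hfree'],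
      fun σ v => by simp only [Sat, hsat, hsat', not_or]⟩
  | and _ _ ihφ ihψ =>
    obtain ⟨χ, hχ, hfree, hsat⟩ := ihφ
    obtain ⟨χ', hχ', hfree', hsat'⟩ := ihψ
    exact ⟨.or χ χ', .or hχ hχ', by simp only [freeVars, hfree, hfree'],
      fun σ v => by simp only [Sat, hsat, hsat', not_and_or]⟩
  | @ex x y φ hx _ ih =>
    obtain ⟨χ, hχ, hfree, hsat⟩ := ih
    exact ⟨.all y (.imp (.lt x y) χ), .all hx hχ, by simp only [freeVars, hfree],
      fun σ v => by simp only [Sat, hsat, not_exists, not_and]⟩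
  | @all x y z φ hx hz _ ih =>
    obtain ⟨χ, hχ, hfree, hsat⟩ := ih
    exact ⟨.ex y (.and (.and (.lt x y) (.lt y z)) χ), .ex hx hz hχ, by simp only [freeVars, hfree],
      fun σ v => by simp only [Sat, hsat, not_forall, exists_prop]⟩

theorem IsSafety.exists_dual {φ : FO P} (hφ : IsSafety φ) : ∃ χ : FO P,
    χ.IsCoSafety ∧ χ.freeVars = φ.freeVars ∧ ∀ σ v, Sat σ v χ ↔ ¬ Sat σ v φ := by
  induction hφ with
  | atomic hφ =>
    obtain ⟨χ, h, -, h'⟩ := hφ.exists_dual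
    exact ⟨χ, h, h'⟩
  | or _ _ ihφ ihψ =>
    obtain ⟨χ, hχ, hfree, hsat⟩ := ihφ
    obtain ⟨χ', hχ', hfree', hsat'⟩ := ihψ
    exact ⟨.and χ χ', .and hχ hχ', by simp only [freeVars, hfree, hfree'],
      fun σ v => by simp only [Sat, hsat, hsat', not_or]⟩
  | and _ _ ihφ ihψ =>
    obtain ⟨χ, hχ, hfree, hsat⟩ := ihφ
    obtain ⟨χ', hχ', hfree', hsat'⟩ := ihψ
    exact ⟨.or χ χ', .or hχ hχ', by simp only [freeVars, hfree, hfree'],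
      fun σ v => by simp only [Sat, hsat, hsat', not_and_or]⟩
  | @ex x y z φ hx hz _ ih =>
    obtain ⟨χ, hχ, hfree, hsat⟩ := ih
    exact ⟨.all y (.imp (.and (.lt x y) (.lt y z)) χ), .all hx hz hχ,
      by simp only [freeVars, hfree], fun σ v => by simp only [Sat, hsat, not_exists, not_and]⟩
  | @all x y φ hx _ ih =>
    obtain ⟨χ, hχ, hfree, hsat⟩ := ih
    exact ⟨.ex y (.and (.lt x y) χ), .ex hx hχ, by simp only [freeVars, hfree],
      fun σ v => by simp only [Sat, hsat, not_forall, exists_prop]⟩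

theorem mem_safetyFOLanguages_iff {L : Set (StateSeq P)} :
    L ∈ safetyFOLanguages P ↔ Lᶜ ∈ coSafetyFOLanguages P := by
  constructor
  · rintro ⟨φ, x, hφ, hx, rfl⟩
    obtain ⟨χ, hχ, hfree, hsat⟩ := hφ.exists_dual
    exact ⟨χ, x, hχ, hfree.trans hx, Set.ext fun σ => (hsat σ _).symm⟩
  · rintro ⟨φ, x, hφ, hx, h⟩
    obtain ⟨χ, hχ, hfree, hsat⟩ := hφ.exists_dual
    refine ⟨χ, x, hχ, hfree.trans hx, ?_⟩
    rw [← compl_compl L, h]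
    exact Set.ext fun σ => (hsat σ _).symm

end FO

theorem mainTheorem3 (P : Type u) [Nonempty P] :
    coSafetyLTLLanguages P = coSafetyFOLanguages P ∧
      safetyLTLLanguages P = safetyFOLanguages P := by
  refine ⟨coSafetyLTLLanguages_eq, Set.ext fun L => ?_⟩
  rw [LTL.mem_safetyLTLLanguages_iff, FO.mem_safetyFOLanguages_iff, coSafetyLTLLanguages_eq]
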